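/- Let $n\ge 0$, $T\ge 1$, and let $q_1,\dots,q_n,b_1,\dots,b_n:\mathbb{R}^n\to\mathbb{R}$ be differentiable with every $b_k>0$. Let $z_0,\dots,z_T$ be an $\mathbb{R}^n$-valued process with $$z_{k,t}=q_k(z_{t-1})+\frac{1}{b_k(z_{t-1})}\,\varepsilon_{k,t}\qquad(1\le t\le T,\ 1\le k\le n),$$ where for each $t$ the noise terms $\varepsilon_{1,t},\dots,\varepsilon_{n,t}$ are standard Gaussian, mutually independent, and jointly independent of $z_{t-1}$. The observations are $x_t=g(z_t)$, where $g:\mathbb{R}^n\to\mathcal{X}$ is invertible and continuous with continuous inverse, onto a topological space $\mathcal{X}$. Let $f:\mathcal{X}\to\mathbb{R}^n$ be invertible and continuous with continuous inverse, and put $\hat z_t=f(x_t)$. Fix $t\in\{1,\dots,T\}$ and suppose that the components of $\hat z_t$ are mutually independent conditional on $\hat z_{t-1}$; if $t=1$, suppose also that the law of $z_0$ gives positive mass to every non-empty open set. Suppose that for each value $z=(z_1,\dots,z_n)\in\mathbb{R}^n$ of the current latent state, the $2n$ vector functions of $u=z_{t-1}\in\mathbb{R}^n$ $$b_k\frac{\partial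 b_k}{\partial u}\qquad\text{and}\qquad 2\,b_k\frac{\partial b_k}{\partial u}\,(z_k-q_k)-b_k^2\,\frac{\partial q_k}{\partial u},\qquad k=1,\dots,n,$$ are linearly independent over $\mathbb{R}$. Then the latent state is an invertible component-wise transformation of a permutation of the estimated one: there are a permutation $\sigma$ of $\{1,\dots,n\}$ and homeomorphisms $\tau_1,\dots,\tau_n:\mathbb{R}\to\mathbb{R}$ such that $(g^{-1}(x))_k=\tau_k\big(f(x)_{\sigma(k)}\big)$ for all $x\in\mathcal{X}$ and all $k$; in particular $z_{k,s}=\tau_k(\hat z_{\sigma(k),s})$ for all $s$ and $k$. -/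

import Mathlib

open MeasureTheory ProbabilityTheory

noncomputable section

/-- The vector of partial derivatives `(∂φ/∂u₁, …, ∂φ/∂uₙ)` of `φ : ℝⁿ → ℝ` at `u`. -/
def partials {n : ℕ} (φ : (Fin n → ℝ) → ℝ) (u : Fin n → ℝ) : Fin n → ℝ :=
  fun l => fderiv ℝ φ u (Pi.single l 1)

/-- The `2n` vector functions of the previous latent state `u`, for a fixed value `z` of the
current latent state: for `k = 1, …, n`
* `b_k ∂b_k/∂u`,
* `2 b_k ∂b_k/∂u (z_k - q_k) - b_k² ∂q_k/∂u`.

With `η_k = log b_k(u) - b_k(u)² (z_k - q_k(u))² / 2`, they are `-1/2` times the partial derivative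
in `u` of `∂²η_k/∂z_k²`, and `-1` times the partial derivative in `u` of `∂η_k/∂z_k`. -/
def variabilityVectors {n : ℕ} (q b : Fin n → (Fin n → ℝ) → ℝ) (z : Fin n → ℝ) :
    Fin n ⊕ Fin n → (Fin n → ℝ) → (Fin n → ℝ)
  | Sum.inl k => fun u => b k u • partials (b k) u
  | Sum.inr k => fun u =>
      (2 * b k u * (z k - q k u)) • partials (b k) u - (b k u ^ 2) • partials (q k) u

/-- The latent process `z_0, …, z_T` with heterogeneous Gaussian noise:
`z_{k,t+1} = q_k(z_t) + ε_{k,t+1} / b_k(z_t)`, where the `ε_{k,t+1}` are standard Gaussian,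
mutually independent over `k`, and jointly independent from `z_t`. The law of the initial state
`z_0` is arbitrary. -/
structure IsHeterogeneousNoiseProcess {Ω : Type*} [MeasurableSpace Ω] (μ : Measure Ω) {n : ℕ}
    (T : ℕ) (q b : Fin n → (Fin n → ℝ) → ℝ) (z ε : ℕ → Ω → Fin n → ℝ) : Prop where
  measurable_state : ∀ t, Measurable (z t)
  measurable_noise : ∀ t, Measurable (ε t)
  noise_law : ∀ t < T, ∀ k, HasLaw (fun ω => ε (t + 1) ω k) (gaussianReal 0 1) μ
  noise_indep : ∀ t < T, iIndepFun (fun k ω => ε (t + 1) ω k) μ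
  noise_indep_state : ∀ t < T, IndepFun (ε (t + 1)) (z t) μ
  transition : ∀ t < T, ∀ᵐ ω ∂μ, ∀ k,
    z (t + 1) ω k = q k (z t ω) + 1 / b k (z t ω) * ε (t + 1) ω k

end

-- Let `h` be the homeomorphism from estimated to true latent states. Given `z_t = u`, the law of
-- the next estimated state is the Gaussian transition law transported by `h.symm`. Conditional
-- independence makes it a product for almost every `u`, hence for a dense set of `u`, because `z_t`
-- has full support (`ae_isProductOnRationalBoxes`).
--
-- For two such states `u`, `v`, the ratio of the two transition densities, read through `h`, is a
-- product of functions of one coordinate (`density_ratio_eq`). The reference measure cancels in the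
-- ratio, so `h` needs no Jacobian and continuity suffices. The logarithm of the ratio is a
-- combination of the `h_k ^ 2` and `h_k`, up to a constant, and its mixed differences vanish. As
-- `u` varies, linear independence forces the mixed differences of each `h_k` and each `h_k ^ 2` to
-- vanish (`coeff_eq_zero_of_linearIndependent`).
--
-- A function that is additively separable together with its square depends on at most one
-- coordinate (`AdditivelySeparable.eq_of_coord_eq`). Bijectivity of `h` then turns the choice of
-- coordinates into a permutation.

-- Homeomorphisms whose components and their squares are separable

/-- The function `F` on `ℝⁿ` is a sum of functions of one coordinate each, expressed as the
vanishing of all mixed differences. -/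
def AdditivelySeparable {n : ℕ} (F : (Fin n → ℝ) → ℝ) : Prop :=
  ∀ (i : Fin n) (x y : Fin n → ℝ),
    F x + F y = F (Function.update x i (y i)) + F (Function.update y i (x i))

theorem exists_apply_update_ne {n : ℕ} {F : (Fin n → ℝ) → ℝ} (hF : Function.Surjective F) :
    ∃ i x s, F (Function.update x i s) ≠ F x := by
  by_contra! H
  have key : ∀ (x y : Fin n → ℝ) (S : Finset (Fin n)), F (S.piecewise y x) = F x := by
    intro x y S
    induction S using Finset.induction_on with
    | empty => simp
    | insert a S ha ih => rw [Finset.piecewise_insert, H, ih]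
  obtain ⟨x, hx⟩ := hF 0
  obtain ⟨y, hy⟩ := hF 1
  have := key x y Finset.univ
  simp [hx, hy] at this

/-- If `F` and `F²` are both additively separable and `F` varies with the coordinate `i`, then `F`
is a function of that coordinate alone. -/
theorem AdditivelySeparable.eq_of_coord_eq {n : ℕ} {F : (Fin n → ℝ) → ℝ}
    (h1 : AdditivelySeparable F) (h2 : AdditivelySeparable fun x => F x ^ 2)
    {i : Fin n} {x : Fin n → ℝ} {s : ℝ} (hne : F (Function.update x i s) ≠ F x)
    {y y' : Fin n → ℝ} (hy : y i = y' i) : F y = F y' := by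
  have swap : ∀ w : Fin n → ℝ, F (Function.update w i (x i)) = F x := by
    intro w
    have e1 := h1 i x (Function.update w i s)
    have e2 := h2 i x (Function.update w i s)
    simp only [Function.update_self, Function.update_idem] at e1 e2
    -- Separability of `F` gives `d = b + c - a` for the four values, and that of `F ^ 2` gives `a²
    -- + d² = b² + c²`; together `(a - b) * (a - c) = 0`.
    have : (F x - F (Function.update x i s)) * (F x - F (Function.update w i (x i))) = 0 := by
      have e3 : F (Function.update w i s) =
        F (Function.update x i s) + F (Function.update w i (x i)) - F x := by linarith
      rw [e3] at e2
      nlinarith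
    rcases mul_eq_zero.1 this with h | h
    · exact absurd (by linarith) hne
    · linarith
  have e := h1 i y (Function.update y' i (x i))
  simp only [Function.update_self, Function.update_idem, swap] at e
  rw [hy, Function.update_eq_self] at e
  linarith

/-- Each component depends on a single coordinate `σ k`. A coordinate missed by `σ` would not affect
`h` at all, against injectivity, so `σ` is a permutation; each `τ k` is `h` restricted to a
coordinate axis. -/
theorem Homeomorph.exists_perm_of_additivelySeparable {n : ℕ} (h : (Fin n → ℝ) ≃ₜ (Fin n → ℝ))
    (h1 : ∀ k, AdditivelySeparable fun x => h x k)
    (h2 : ∀ k, AdditivelySeparable fun x => h x k ^ 2) :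
    ∃ (σ : Equiv.Perm (Fin n)) (τ : Fin n → (ℝ ≃ₜ ℝ)), ∀ x k, h x k = τ k (x (σ k)) := by
  have hsurj : ∀ k, Function.Surjective fun x => h x k := fun k =>
    (Function.surjective_eval k).comp h.surjective
  choose σ x₀ s₀ hne using fun k => exists_apply_update_ne (hsurj k)
  have dep : ∀ k {y y' : Fin n → ℝ}, y (σ k) = y' (σ k) → h y k = h y' k := fun k _ _ hy =>
    (h1 k).eq_of_coord_eq (h2 k) (hne k) hy
  have σsurj : Function.Surjective σ := by
    by_contra hns
    obtain ⟨j, hj⟩ : ∃ j, ∀ k, σ k ≠ j := by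
      simpa [Function.Surjective] using hns
    have : h (Function.update 0 j 1) = h 0 :=
      funext fun k => dep k (by simp [Function.update_of_ne (hj k)])
    have := congrFun (h.injective this) j
    simp at this
  have σinj : Function.Injective σ := Finite.injective_iff_surjective.2 σsurj
  have val : ∀ k (x : Fin n → ℝ), h (Function.update 0 (σ k) (x (σ k))) k = h x k := fun k x =>
    dep k (by simp)
  have right : ∀ k s, h (Function.update 0 (σ k) (h.symm (Function.update 0 k s) (σ k))) k = s := by
    intro k s
    rw [val]; simp
  have inj : ∀ k, Function.Injective fun r : ℝ => h (Function.update 0 (σ k) r) k := by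
    intro k r r' hr
    have : h (Function.update 0 (σ k) r) = h (Function.update 0 (σ k) r') := by
      funext l
      by_cases hl : l = k
      · subst hl; exact hr
      · have : σ l ≠ σ k := fun e => hl (σinj e)
        exact dep l (by simp [Function.update_of_ne this])
    simpa using congrFun (h.injective this) (σ k)
  refine ⟨Equiv.ofBijective σ ⟨σinj, σsurj⟩, fun k =>
    { toFun := fun r => h (Function.update 0 (σ k) r) k
      invFun := fun s => h.symm (Function.update 0 k s) (σ k)
      left_inv := fun r => inj k (right k _)
      right_inv := right k
      continuous_toFun := (continuous_apply k).comp
        (h.continuous.comp (continuous_const.update (σ k) continuous_id))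
      continuous_invFun := (continuous_apply (σ k)).comp
        (h.symm.continuous.comp (continuous_const.update k continuous_id)) }, fun x k => ?_⟩
  exact (val k x).symm

-- Differentiation in the previous state and linear independence

theorem partials_zero_of_dense_const {n : ℕ} {G : (Fin n → ℝ) → ℝ} (hG : Continuous G)
    {U : Set (Fin n → ℝ)} (hU : Dense U) (hc : ∀ u ∈ U, ∀ v ∈ U, G u = G v) (u : Fin n → ℝ) :
    partials G u = 0 := by
  obtain ⟨u₀, hu₀⟩ := hU.nonempty
  have : G = fun _ => G u₀ :=
    Continuous.ext_on hU hG continuous_const fun v hv => hc v hv u₀ hu₀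
  rw [this]
  funext l
  simp [partials]

/-- Under the linear independence of the variability vectors, a combination of `b_k²` and `b_k² q_k`
that is constant on a dense set has only zero coefficients. -/
theorem coeff_eq_zero_of_linearIndependent {n : ℕ} {q b : Fin n → (Fin n → ℝ) → ℝ}
    (hq : ∀ k, Differentiable ℝ (q k)) (hb : ∀ k, Differentiable ℝ (b k))
    (hlin : LinearIndependent ℝ (variabilityVectors q b 0))
    {U : Set (Fin n → ℝ)} (hU : Dense U) {α β : Fin n → ℝ}
    (hc : ∀ u ∈ U, ∀ v ∈ U, ∑ k, (-(b k u ^ 2) / 2 * α k + b k u ^ 2 * q k u * β k) =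
      ∑ k, (-(b k v ^ 2) / 2 * α k + b k v ^ 2 * q k v * β k)) :
    (∀ k, α k = 0) ∧ ∀ k, β k = 0 := by
  have hd : Differentiable ℝ fun u =>
      ∑ k, (-(b k u ^ 2) / 2 * α k + b k u ^ 2 * q k u * β k) := by
    fun_prop
  have hp := partials_zero_of_dense_const hd.continuous hU hc
  -- The derivative of the constant combination is minus this sum, whence the `neg_eq_zero` below.
  have hsum : ∑ i, Sum.elim α β i • variabilityVectors q b 0 i = 0 := by
    funext u l
    have h0 := congrFun (hp u) l
    have hder : HasFDerivAt (fun u => ∑ k, (-(b k u ^ 2) / 2 * α k + b k u ^ 2 * q k u * β k))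
        (∑ k, ((-(b k u) * α k + 2 * b k u * q k u * β k) • fderiv ℝ (b k) u
          + (b k u ^ 2 * β k) • fderiv ℝ (q k) u)) u := by
      refine HasFDerivAt.fun_sum fun k _ => ?_
      have hb' := (hb k u).hasFDerivAt
      have hq' := (hq k u).hasFDerivAt
      have h3 := (((hb'.pow 2).mul_const (-(α k) / 2))).add (((hb'.pow 2).mul hq').mul_const (β k))
      refine (h3.congr_fderiv ?_).congr_of_eventuallyEq (.of_forall fun v => ?_)
      · ext v
        simp
        ring
      · simp
        ring
    rw [partials, hder.fderiv] at h0
    simp only [Fintype.sum_sum_type, Sum.elim_inl, Sum.elim_inr, variabilityVectors,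
      Finset.sum_apply, Pi.smul_apply, smul_eq_mul, Pi.sub_apply, Pi.zero_apply, partials]
    simp only [sum_apply, add_apply,
      smul_apply, smul_eq_mul, Pi.zero_apply] at h0
    refine neg_eq_zero.1 (Eq.trans ?_ h0)
    rw [← Finset.sum_add_distrib, ← Finset.sum_neg_distrib]
    refine Finset.sum_congr rfl fun k _ => ?_
    ring
  have := Fintype.linearIndependent_iff.1 hlin _ hsum
  exact ⟨fun k => this (Sum.inl k), fun k => this (Sum.inr k)⟩

-- Ratios of densities of product measures

open Filter Topology in
/-- Let `P` and `P₀` have densities `p` and `p₀` with respect to `ν`. If on all sufficiently small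
boxes `V a` around the four points `w a` both measures satisfy
`P (V 0) * P (V 1) = P (V 2) * P (V 3)`, then `p / p₀` satisfies the same relation at the points,
as an inequality. -/
theorem density_ratio_le {E : Type*} [TopologicalSpace E] [MeasurableSpace E]
    [OpensMeasurableSpace E] {ν P P₀ : Measure E} [IsFiniteMeasure P₀] [P₀.IsOpenPosMeasure]
    {p p₀ : E → ℝ} (hp : Continuous p) (hp₀ : Continuous p₀) (hpos : ∀ x, 0 < p x)
    (hpos₀ : ∀ x, 0 < p₀ x)
    (hP : P = ν.withDensity fun x => ENNReal.ofReal (p x))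
    (hP₀ : P₀ = ν.withDensity fun x => ENNReal.ofReal (p₀ x)) (w : Fin 4 → E)
    (hbox : ∀ N : Fin 4 → Set E, (∀ a, N a ∈ 𝓝 (w a)) → ∃ V : Fin 4 → Set E,
      (∀ a, V a ⊆ N a) ∧ (∀ a, IsOpen (V a)) ∧ (∀ a, w a ∈ V a) ∧
      P (V 0) * P (V 1) = P (V 2) * P (V 3) ∧ P₀ (V 0) * P₀ (V 1) = P₀ (V 2) * P₀ (V 3)) :
    p (w 2) / p₀ (w 2) * (p (w 3) / p₀ (w 3)) ≤ p (w 0) / p₀ (w 0) * (p (w 1) / p₀ (w 1)) := by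
  by_contra! hlt
  set r : E → ℝ := fun x => p x / p₀ x with hr
  have hrc : Continuous r := hp.div hp₀ fun x => (hpos₀ x).ne'
  have hrpos : ∀ x, 0 < r x := fun x => div_pos (hpos x) (hpos₀ x)
  obtain ⟨δ, hδ, hδ2, hδ3, hδlt⟩ : ∃ δ : ℝ, 0 < δ ∧ δ < r (w 2) ∧ δ < r (w 3) ∧
      (r (w 0) + δ) * (r (w 1) + δ) < (r (w 2) - δ) * (r (w 3) - δ) := by
    have h1 : ∀ᶠ δ in 𝓝 (0 : ℝ), (r (w 0) + δ) * (r (w 1) + δ) < (r (w 2) - δ) * (r (w 3) - δ) := by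
      refine ContinuousAt.eventually_lt (by fun_prop) (by fun_prop) ?_
      simpa using hlt
    have h2 : ∀ᶠ δ in 𝓝 (0 : ℝ), δ < r (w 2) := eventually_lt_nhds (hrpos _)
    have h3 : ∀ᶠ δ in 𝓝 (0 : ℝ), δ < r (w 3) := eventually_lt_nhds (hrpos _)
    obtain ⟨δ, ⟨⟨h1, h2⟩, h3⟩, hδ⟩ :=
      ((((h1.and h2).and h3).filter_mono nhdsWithin_le_nhds).and
        (self_mem_nhdsWithin (a := (0 : ℝ)) (s := Set.Ioi 0))).exists
    exact ⟨δ, hδ, h2, h3, h1⟩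
  obtain ⟨V, hVN, hVo, hwV, hV, hV₀⟩ := hbox
    (fun a => r ⁻¹' Set.Ioo (r (w a) - δ) (r (w a) + δ))
    fun a => hrc.continuousAt.preimage_mem_nhds (Ioo_mem_nhds (by linarith) (by linarith))
  have upper : ∀ a, P (V a) ≤ ENNReal.ofReal (r (w a) + δ) * P₀ (V a) := fun a => by
    rw [hP, hP₀, withDensity_apply _ (hVo a).measurableSet, withDensity_apply _ (hVo a).measurableSet,
      ← lintegral_const_mul' _ _ ENNReal.ofReal_ne_top]
    refine setLIntegral_mono' (hVo a).measurableSet fun x hx => ?_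
    rw [← ENNReal.ofReal_mul (by linarith [hrpos (w a)])]
    refine ENNReal.ofReal_le_ofReal ?_
    rw [← div_le_iff₀ (hpos₀ x)]
    exact (hVN a hx).2.le
  have lower : ∀ a, 0 ≤ r (w a) - δ → ENNReal.ofReal (r (w a) - δ) * P₀ (V a) ≤ P (V a) := by
    intro a ha
    rw [hP, hP₀, withDensity_apply _ (hVo a).measurableSet, withDensity_apply _ (hVo a).measurableSet,
      ← lintegral_const_mul' _ _ ENNReal.ofReal_ne_top]
    refine setLIntegral_mono' (hVo a).measurableSet fun x hx => ?_
    rw [← ENNReal.ofReal_mul ha]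
    refine ENNReal.ofReal_le_ofReal ?_
    rw [← le_div_iff₀ (hpos₀ x)]
    exact (hVN a hx).1.le
  have hV₀pos : ∀ a, P₀ (V a) ≠ 0 := fun a => ((hVo a).measure_pos _ ⟨_, hwV a⟩).ne'
  have := calc
    ENNReal.ofReal ((r (w 2) - δ) * (r (w 3) - δ)) * (P₀ (V 0) * P₀ (V 1))
        = (ENNReal.ofReal (r (w 2) - δ) * P₀ (V 2)) * (ENNReal.ofReal (r (w 3) - δ) * P₀ (V 3)) := by
          rw [ENNReal.ofReal_mul (by linarith), hV₀]; ring
      _ ≤ P (V 2) * P (V 3) := mul_le_mul' (lower 2 (by linarith)) (lower 3 (by linarith))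
      _ = P (V 0) * P (V 1) := hV.symm
      _ ≤ (ENNReal.ofReal (r (w 0) + δ) * P₀ (V 0)) * (ENNReal.ofReal (r (w 1) + δ) * P₀ (V 1)) :=
          mul_le_mul' (upper 0) (upper 1)
      _ = ENNReal.ofReal ((r (w 0) + δ) * (r (w 1) + δ)) * (P₀ (V 0) * P₀ (V 1)) := by
          rw [ENNReal.ofReal_mul (by linarith [hrpos (w 0)])]; ring
  -- The common factor is finite and, by full support of `P₀`, nonzero.
  rw [ENNReal.mul_le_mul_iff_left (mul_ne_zero (hV₀pos 0) (hV₀pos 1))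
    (ENNReal.mul_ne_top (measure_ne_top _ _) (measure_ne_top _ _)),
    ENNReal.ofReal_le_ofReal_iff
      (mul_nonneg (by linarith [hrpos (w 0)]) (by linarith [hrpos (w 1)]))] at this
  linarith

/-- A measure on `ℝⁿ` that is a product on boxes with rational end points. -/
def IsProductOnRationalBoxes {n : ℕ} (Q : Measure (Fin n → ℝ)) : Prop :=
  ∀ a c : Fin n → ℚ, Q (Set.univ.pi fun i => Set.Ioo (a i : ℝ) (c i)) =
    ∏ i, Q {x | x i ∈ Set.Ioo (a i : ℝ) (c i)}

theorem exists_rational_box_subset {n : ℕ} {x : Fin n → ℝ} {N : Set (Fin n → ℝ)}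
    (hN : N ∈ nhds x) : ∃ δ > 0, ∀ a c : Fin n → ℚ,
      (∀ i, x i - δ < a i ∧ (a i : ℝ) < x i ∧ x i < c i ∧ (c i : ℝ) < x i + δ) →
      (Set.univ.pi fun i => Set.Ioo (a i : ℝ) (c i)) ⊆ N := by
  obtain ⟨δ, hδ, hball⟩ := Metric.mem_nhds_iff.1 hN
  refine ⟨δ / 2, by positivity, fun a c hac y hy => hball ?_⟩
  rw [Metric.mem_ball]
  refine lt_of_le_of_lt ((dist_pi_le_iff (r := δ / 2) (by positivity)).2 fun i => ?_) (by linarith)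
  have := hac i
  have h2 := hy i trivial
  rw [Real.dist_eq, abs_le]
  constructor <;> linarith [h2.1, h2.2]

theorem exists_rational_enclosure {n : ℕ} (x : Fin n → ℝ) {δ : ℝ} (hδ : 0 < δ) :
    ∃ a c : Fin n → ℚ, ∀ i, x i - δ < a i ∧ (a i : ℝ) < x i ∧ x i < c i ∧ (c i : ℝ) < x i + δ := by
  choose a ha using fun i => exists_rat_btwn (show x i - δ < x i by linarith)
  choose c hc using fun i => exists_rat_btwn (show x i < x i + δ by linarith)
  exact ⟨a, c, fun i => ⟨(ha i).1, (ha i).2, (hc i).1, (hc i).2⟩⟩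

/-- Exchanging the `i`-th sides of two boxes only permutes the factors of the product of their
measures. -/
theorem prod_update_mul_prod_update {n : ℕ} {α M : Type*} [CommMonoid M] (m : Fin n → α → M)
    (s t : Fin n → α) (i : Fin n) :
    (∏ j, m j (Function.update s i (t i) j)) * ∏ j, m j (Function.update t i (s i) j) =
      (∏ j, m j (s j)) * ∏ j, m j (t j) := by
  rw [← Finset.prod_mul_distrib, ← Finset.prod_mul_distrib]
  refine Finset.prod_congr rfl fun j _ => ?_
  by_cases h : j = i
  · subst h; simp [mul_comm]
  · simp [h]

/-- The ratio of the densities of two measures that both become product measures under the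
homeomorphism `h.symm` is a product in the new coordinates. -/
theorem density_ratio_eq {n : ℕ} (h : (Fin n → ℝ) ≃ₜ (Fin n → ℝ)) {ν P P₀ : Measure (Fin n → ℝ)}
    [IsFiniteMeasure P₀] [P₀.IsOpenPosMeasure]
    {p p₀ : (Fin n → ℝ) → ℝ} (hp : Continuous p) (hp₀ : Continuous p₀) (hpos : ∀ x, 0 < p x)
    (hpos₀ : ∀ x, 0 < p₀ x)
    (hP : P = ν.withDensity fun x => ENNReal.ofReal (p x))
    (hP₀ : P₀ = ν.withDensity fun x => ENNReal.ofReal (p₀ x))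
    (hQ : IsProductOnRationalBoxes (P.map h.symm)) (hQ₀ : IsProductOnRationalBoxes (P₀.map h.symm))
    (i : Fin n) (x y : Fin n → ℝ) :
    p (h x) / p₀ (h x) * (p (h y) / p₀ (h y)) =
      p (h (Function.update x i (y i))) / p₀ (h (Function.update x i (y i))) *
        (p (h (Function.update y i (x i))) / p₀ (h (Function.update y i (x i)))) := by
  have main : ∀ x y : Fin n → ℝ,
      p (h (Function.update x i (y i))) / p₀ (h (Function.update x i (y i))) *
        (p (h (Function.update y i (x i))) / p₀ (h (Function.update y i (x i)))) ≤
      p (h x) / p₀ (h x) * (p (h y) / p₀ (h y)) := by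
    intro x y
    set ξ : Fin 4 → Fin n → ℝ :=
      ![x, y, Function.update x i (y i), Function.update y i (x i)] with hξ
    refine density_ratio_le hp hp₀ hpos hpos₀ hP hP₀ (fun a => h (ξ a)) fun N hN => ?_
    choose δ hδ hδN using fun a =>
      exists_rational_box_subset (h.continuous.continuousAt.preimage_mem_nhds (hN a))
    obtain ⟨ε, hε, hεδ⟩ : ∃ ε > 0, ∀ a, ε ≤ δ a :=
      ⟨Finset.univ.inf' Finset.univ_nonempty δ, by simpa using hδ,
        fun a => Finset.inf'_le _ (Finset.mem_univ a)⟩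
    obtain ⟨a, c, hac⟩ := exists_rational_enclosure x hε
    obtain ⟨a', c', hac'⟩ := exists_rational_enclosure y hε
    set A : Fin 4 → Fin n → ℚ := ![a, a', Function.update a i (a' i), Function.update a' i (a i)]
      with hA
    set C : Fin 4 → Fin n → ℚ := ![c, c', Function.update c i (c' i), Function.update c' i (c i)]
      with hC
    have hAC : ∀ e j, ξ e j - ε < A e j ∧ (A e j : ℝ) < ξ e j ∧ ξ e j < C e j ∧
        (C e j : ℝ) < ξ e j + ε := by
      intro e j
      have h1 := hac j
      have h2 := hac' j
      by_cases hj : j = i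
      · subst hj
        fin_cases e <;> simp [hξ, hA, hC] <;> grind
      · fin_cases e <;> simp [hξ, hA, hC, hj] <;> grind
    have hprod : ∀ Q : Measure (Fin n → ℝ), IsProductOnRationalBoxes (Q.map h.symm) →
        ∀ B : Fin 4 → Set (Fin n → ℝ),
          (B = fun e => h.symm ⁻¹' Set.univ.pi fun j => Set.Ioo (A e j : ℝ) (C e j)) →
          Q (B 0) * Q (B 1) = Q (B 2) * Q (B 3) := by
      intro Q hQ B hB
      have hBQ : ∀ e, Q (B e) = ∏ j, (Q.map h.symm) {x | x j ∈ Set.Ioo (A e j : ℝ) (C e j)} := by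
        intro e
        rw [← hQ, Measure.map_apply h.symm.continuous.measurable
          (MeasurableSet.univ_pi fun _ => measurableSet_Ioo), hB]
      simp only [hBQ]
      have := prod_update_mul_prod_update
        (fun j (s : ℚ × ℚ) => (Q.map h.symm) {x : Fin n → ℝ | x j ∈ Set.Ioo (s.1 : ℝ) s.2})
        (fun j => (a j, c j)) (fun j => (a' j, c' j)) i
      rw [eq_comm] at this
      convert! this using 4
      all_goals
        rename_i j _
        by_cases hj : j = i
        · subst hj; simp [hA, hC]
        · simp [hA, hC, hj]
    refine ⟨fun e => h.symm ⁻¹' Set.univ.pi fun j => Set.Ioo (A e j : ℝ) (C e j), fun e => ?_,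
      fun e => ?_, fun e => ?_, hprod P hQ _ rfl, hprod P₀ hQ₀ _ rfl⟩
    · intro v hv
      have := hδN e (A e) (C e) (fun j => ⟨by linarith [hεδ e, hAC e j], (hAC e j).2.1,
        (hAC e j).2.2.1, by linarith [hεδ e, hAC e j]⟩) hv
      simpa using this
    · exact (isOpen_set_pi Set.finite_univ fun _ _ => isOpen_Ioo).preimage h.symm.continuous
    · simpa using fun j => ⟨(hAC e j).2.1, (hAC e j).2.2.1⟩
  -- Exchanging the `i`-th coordinates is an involution, so the inequality at the exchanged points
  -- is the reverse one.
  refine le_antisymm ?_ (main x y)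
  simpa using main (Function.update x i (y i)) (Function.update y i (x i))

-- Gaussian transition laws and separability

theorem pi_gaussianReal_eq_withDensity {n : ℕ} (m : Fin n → ℝ) {v : Fin n → NNReal}
    (hv : ∀ k, v k ≠ 0) :
    Measure.pi (fun k => gaussianReal (m k) (v k)) =
      volume.withDensity fun x => ENNReal.ofReal (∏ k, gaussianPDFReal (m k) (v k) (x k)) := by
  refine Measure.pi_eq fun s hs => ?_
  rw [withDensity_apply _ (MeasurableSet.univ_pi hs), volume_pi, Measure.restrict_pi_pi,
    ← ofReal_integral_eq_lintegral_ofReal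
      (Integrable.fintype_prod fun k => (integrable_gaussianPDFReal _ _).restrict)
      (ae_of_all _ fun x => Finset.prod_nonneg fun k _ => gaussianPDFReal_nonneg _ _ _),
    integral_fintype_prod_eq_prod (fun k => gaussianPDFReal (m k) (v k)),
    ENNReal.ofReal_prod_of_nonneg fun k _ => integral_nonneg (gaussianPDFReal_nonneg _ _)]
  exact Finset.prod_congr rfl fun k _ => (gaussianReal_apply_eq_integral _ (hv k) _).symm

/-- The law of the next latent state when the current one is `u`. -/
noncomputable def transitionLaw {n : ℕ} (q b : Fin n → (Fin n → ℝ) → ℝ) (u : Fin n → ℝ) :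
    Measure (Fin n → ℝ) :=
  Measure.pi fun k => gaussianReal (q k u) (Real.toNNReal ((b k u ^ 2)⁻¹))

/-- The density of `transitionLaw`. -/
noncomputable def transitionDensity {n : ℕ} (q b : Fin n → (Fin n → ℝ) → ℝ) (u v : Fin n → ℝ) : ℝ :=
  ∏ k, gaussianPDFReal (q k u) (Real.toNNReal ((b k u ^ 2)⁻¹)) (v k)

section
variable {n : ℕ} {q b : Fin n → (Fin n → ℝ) → ℝ}

theorem transitionVariance_ne_zero (hb : ∀ k u, 0 < b k u) (k : Fin n) (u : Fin n → ℝ) :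
    Real.toNNReal ((b k u ^ 2)⁻¹) ≠ 0 := by
  have := hb k u
  simp only [ne_eq, Real.toNNReal_eq_zero, not_le]
  positivity

instance (u : Fin n → ℝ) : IsProbabilityMeasure (transitionLaw q b u) := by
  unfold transitionLaw; infer_instance

theorem isOpenPosMeasure_transitionLaw (hb : ∀ k u, 0 < b k u) (u : Fin n → ℝ) :
    (transitionLaw q b u).IsOpenPosMeasure := by
  unfold transitionLaw
  have : ∀ k, (gaussianReal (q k u) (Real.toNNReal ((b k u ^ 2)⁻¹))).IsOpenPosMeasure := fun k =>
    (gaussianReal_absolutelyContinuous' _ (transitionVariance_ne_zero hb k u)).isOpenPosMeasure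
  infer_instance

theorem transitionLaw_eq_withDensity (hb : ∀ k u, 0 < b k u) (u : Fin n → ℝ) :
    transitionLaw q b u =
      volume.withDensity fun v => ENNReal.ofReal (transitionDensity q b u v) :=
  pi_gaussianReal_eq_withDensity _ fun k => transitionVariance_ne_zero hb k u

theorem transitionDensity_pos (hb : ∀ k u, 0 < b k u) (u v : Fin n → ℝ) :
    0 < transitionDensity q b u v :=
  Finset.prod_pos fun k _ => gaussianPDFReal_pos _ _ _ (transitionVariance_ne_zero hb k u)

theorem continuous_transitionDensity (u : Fin n → ℝ) : Continuous (transitionDensity q b u) := by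
  unfold transitionDensity gaussianPDFReal
  fun_prop

/-- Isolates the exponential-family form: sufficient statistics `v k ^ 2` and `v k`, plus a term
free of `v`. -/
theorem log_transitionDensity (hb : ∀ k u, 0 < b k u) (u v : Fin n → ℝ) :
    Real.log (transitionDensity q b u v) =
      ∑ k, (-(b k u ^ 2) / 2 * v k ^ 2 + b k u ^ 2 * q k u * v k) +
      ∑ k, (Real.log (√(2 * Real.pi * (b k u ^ 2)⁻¹))⁻¹ - b k u ^ 2 * q k u ^ 2 / 2) := by
  unfold transitionDensity
  rw [Real.log_prod fun k _ => (gaussianPDFReal_pos _ _ _ (transitionVariance_ne_zero hb k u)).ne',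
    ← Finset.sum_add_distrib]
  refine Finset.sum_congr rfl fun k _ => ?_
  have hpos := hb k u
  have hpi := Real.pi_pos
  rw [gaussianPDFReal, Real.coe_toNNReal _ (by positivity), Real.log_mul (by positivity)
    (Real.exp_pos _).ne', Real.log_exp]
  field_simp
  ring

theorem map_gaussian_noise (hb : ∀ k u, 0 < b k u) (u : Fin n → ℝ) :
    (Measure.pi fun _ : Fin n => gaussianReal 0 1).map
      (fun e k => q k u + 1 / b k u * e k) = transitionLaw q b u := by
  have hm : ∀ k, (gaussianReal 0 1).map (fun x => q k u + 1 / b k u * x) =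
      gaussianReal (q k u) (Real.toNNReal ((b k u ^ 2)⁻¹)) := by
    intro k
    have := gaussianReal_map_const_add (μ := 1 / b k u * 0)
      (v := NNReal.mk ((1 / b k u) ^ 2) (sq_nonneg _) * 1) (q k u)
    rw [← gaussianReal_map_const_mul, Measure.map_map (by fun_prop) (by fun_prop)] at this
    rw [show (fun x => q k u + 1 / b k u * x) = (fun x => q k u + x) ∘ fun x => 1 / b k u * x from rfl,
      this]
    congr 1
    · simp
    · ext
      have := hb k u
      rw [Real.coe_toNNReal _ (by positivity)]
      simp
  have : ∀ k, SigmaFinite ((gaussianReal 0 1).map (fun x => q k u + 1 / b k u * x)) := fun k => by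
    rw [hm]; infer_instance
  rw [transitionLaw, ← funext hm]
  exact Measure.pi_map_pi (f := fun k x => q k u + 1 / b k u * x) fun k => by fun_prop

/-- If the transition laws of a dense set of previous states become product measures under the
homeomorphism `h.symm`, then the components of `h` and their squares are additively separable. -/
theorem additivelySeparable_of_dense (hq : ∀ k, Differentiable ℝ (q k))
    (hb : ∀ k, Differentiable ℝ (b k)) (hb_pos : ∀ k u, 0 < b k u)
    (hlin : LinearIndependent ℝ (variabilityVectors q b 0)) (h : (Fin n → ℝ) ≃ₜ (Fin n → ℝ))
    (hU : Dense {u | IsProductOnRationalBoxes ((transitionLaw q b u).map h.symm)}) (k : Fin n) :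
    AdditivelySeparable (fun x => h x k) ∧ AdditivelySeparable fun x => h x k ^ 2 := by
  suffices H : ∀ i x y,
      (∀ k, h x k ^ 2 + h y k ^ 2 - (h (Function.update x i (y i)) k ^ 2 +
        h (Function.update y i (x i)) k ^ 2) = 0) ∧
      (∀ k, h x k + h y k - (h (Function.update x i (y i)) k +
        h (Function.update y i (x i)) k) = 0) from
    ⟨fun i x y => sub_eq_zero.1 ((H i x y).2 k), fun i x y => sub_eq_zero.1 ((H i x y).1 k)⟩
  intro i x y
  refine coeff_eq_zero_of_linearIndependent hq hb hlin hU fun u hu v hv => ?_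
  have := isOpenPosMeasure_transitionLaw hb_pos v (q := q)
  have key := density_ratio_eq h (continuous_transitionDensity u) (continuous_transitionDensity v)
    (transitionDensity_pos hb_pos u) (transitionDensity_pos hb_pos v)
    (transitionLaw_eq_withDensity hb_pos u) (transitionLaw_eq_withDensity hb_pos v) hu hv i x y
  have pos := fun u v => (transitionDensity_pos (q := q) hb_pos u v).ne'
  have key2 := congrArg Real.log key
  rw [Real.log_mul (div_ne_zero (pos _ _) (pos _ _)) (div_ne_zero (pos _ _) (pos _ _)),
    Real.log_mul (div_ne_zero (pos _ _) (pos _ _)) (div_ne_zero (pos _ _) (pos _ _))] at key2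
  -- The terms free of the next state occur equally often on both sides and cancel.
  simp only [Real.log_div (pos _ _) (pos _ _), log_transitionDensity hb_pos] at key2
  have expand : ∀ u, ∑ k, (-(b k u ^ 2) / 2 * (h x k ^ 2 + h y k ^ 2 -
        (h (Function.update x i (y i)) k ^ 2 + h (Function.update y i (x i)) k ^ 2)) +
        b k u ^ 2 * q k u * (h x k + h y k - (h (Function.update x i (y i)) k +
        h (Function.update y i (x i)) k))) =
      ∑ k, (-(b k u ^ 2) / 2 * h x k ^ 2 + b k u ^ 2 * q k u * h x k) +
      ∑ k, (-(b k u ^ 2) / 2 * h y k ^ 2 + b k u ^ 2 * q k u * h y k) -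
      ∑ k, (-(b k u ^ 2) / 2 * h (Function.update x i (y i)) k ^ 2 +
        b k u ^ 2 * q k u * h (Function.update x i (y i)) k) -
      ∑ k, (-(b k u ^ 2) / 2 * h (Function.update y i (x i)) k ^ 2 +
        b k u ^ 2 * q k u * h (Function.update y i (x i)) k) := by
    intro u
    rw [← Finset.sum_add_distrib, ← Finset.sum_sub_distrib, ← Finset.sum_sub_distrib]
    exact Finset.sum_congr rfl fun k _ => by ring
  rw [expand u, expand v]
  linarith

end

-- Conditional laws of consecutive states

section
variable {β γ δ : Type*} [MeasurableSpace β] [MeasurableSpace γ] [MeasurableSpace δ]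

/-- The kernel sending `x` to the law of `F (x, e)`, where `e` has law `ν`. -/
noncomputable def randomMapKernel (ν : Measure γ) [SFinite ν] (F : β × γ → δ) : Kernel β δ :=
  (Kernel.id ×ₖ Kernel.const β ν).map F

theorem randomMapKernel_apply (ν : Measure γ) [SFinite ν] {F : β × γ → δ} (hF : Measurable F)
    (x : β) : randomMapKernel ν F x = ν.map fun e => F (x, e) := by
  rw [randomMapKernel, Kernel.map_apply _ hF, Kernel.prod_apply, Kernel.id_apply,
    Kernel.const_apply, Measure.dirac_prod, Measure.map_map hF measurable_prodMk_left]
  rfl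

instance (ν : Measure γ) [IsProbabilityMeasure ν] (F : β × γ → δ) :
    IsFiniteKernel (randomMapKernel ν F : Kernel β δ) := by
  unfold randomMapKernel; infer_instance

theorem map_prodMk_eq_compProd_randomMapKernel {Ω : Type*} [MeasurableSpace Ω] {μ : Measure Ω}
    [IsProbabilityMeasure μ] {X : Ω → β} {e : Ω → γ} {Y : Ω → δ} (hX : Measurable X)
    (he : Measurable e) (hind : IndepFun e X μ) {ν : Measure γ} [IsProbabilityMeasure ν]
    (hν : μ.map e = ν) {F : β × γ → δ} (hF : Measurable F)
    (hY : Y =ᵐ[μ] fun ω => F (X ω, e ω)) :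
    μ.map (fun ω => (X ω, Y ω)) = μ.map X ⊗ₘ randomMapKernel ν F := by
  have : IsProbabilityMeasure (μ.map X) := Measure.isProbabilityMeasure_map hX.aemeasurable
  have hG : Measurable fun w : β × γ => (w.1, F w) := measurable_fst.prodMk hF
  have h1 : μ.map (fun ω => (X ω, Y ω)) = ((μ.map X).prod ν).map fun w => (w.1, F w) := by
    rw [← hν, ← (indepFun_iff_map_prod_eq_prod_map_map hX.aemeasurable he.aemeasurable).1 hind.symm,
      Measure.map_map hG (hX.prodMk he)]
    exact Measure.map_congr (hY.mono fun ω hω => by simp [hω])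
  ext s hs
  rw [h1, Measure.map_apply hG hs, Measure.prod_apply (hG hs), Measure.compProd_apply hs]
  refine lintegral_congr fun x => ?_
  rw [randomMapKernel_apply _ hF, Measure.map_apply (f := fun e => F (x, e))
    (hF.comp measurable_prodMk_left)
    (measurable_prodMk_left hs)]
  rfl

end

section
variable {Ω : Type*} [MeasurableSpace Ω] {μ : Measure Ω} [IsProbabilityMeasure μ]

/-- If the components of `Y` are conditionally independent given `X` and `κ` is the conditional law
of `Y` given `X`, then almost every `κ (X ω)` is a product on boxes. -/
theorem ae_isProductOnRationalBoxes [StandardBorelSpace Ω] {β : Type*} [MeasurableSpace β] {n : ℕ}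
    {X : Ω → β} {Y : Ω → Fin n → ℝ} (hX : Measurable X) (hY : Measurable Y)
    (hind : iCondIndepFun (MeasurableSpace.comap X inferInstance) hX.comap_le (fun i ω => Y ω i) μ)
    {κ : Kernel β (Fin n → ℝ)} [IsFiniteKernel κ]
    (hκ : μ.map (fun ω => (X ω, Y ω)) = μ.map X ⊗ₘ κ) :
    ∀ᵐ ω ∂μ, IsProductOnRationalBoxes (κ (X ω)) := by
  have hcd := ae_of_ae_map hX.aemeasurable (condDistrib_ae_eq_of_measure_eq_compProd X
    hY.aemeasurable hκ)
  have hexp := fun {s : Set (Fin n → ℝ)} (hs : MeasurableSet s) =>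
    condDistrib_ae_eq_condExp (μ := μ) hX hY hs
  have hcomp := (iCondIndepFun_iff_condExp_inter_preimage_eq_mul _
    (fun i ω => Y ω i) fun i => (measurable_pi_apply i).comp hY).1 hind
  -- Rational end points leave countably many boxes, so one null set serves for all.
  refine ae_all_iff.2 fun a => ae_all_iff.2 fun c => ?_
  have hI : ∀ i, MeasurableSet {x : Fin n → ℝ | x i ∈ Set.Ioo (a i : ℝ) (c i)} := fun i =>
    measurable_pi_apply i measurableSet_Ioo
  have h1 := hcomp Finset.univ (sets := fun i => Set.Ioo (a i : ℝ) (c i))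
    fun i _ => measurableSet_Ioo
  have h2 := hexp (MeasurableSet.univ_pi fun i => measurableSet_Ioo (a := (a i : ℝ)) (b := c i))
  have h3 := ae_all_iff.2 fun i => hexp (hI i)
  have hset : (⋂ i ∈ Finset.univ, (fun ω => Y ω i) ⁻¹' Set.Ioo (a i : ℝ) (c i)) =
      Y ⁻¹' Set.univ.pi fun i => Set.Ioo (a i : ℝ) (c i) := by
    ext ω; simp [Set.mem_pi]
  rw [hset] at h1
  filter_upwards [hcd, h1, h2, h3] with ω e0 e1 e2 e3
  rw [← e2, Finset.prod_apply] at e1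
  have e4 : ((condDistrib Y X μ) (X ω)).real (Set.univ.pi fun i => Set.Ioo (a i : ℝ) (c i)) =
      ∏ i, ((condDistrib Y X μ) (X ω)).real {x | x i ∈ Set.Ioo (a i : ℝ) (c i)} :=
    e1.trans (Finset.prod_congr rfl fun i _ => (e3 i).symm)
  rw [e0] at e4
  simp only [Measure.real, ← ENNReal.toReal_prod] at e4
  exact (ENNReal.toReal_eq_toReal_iff' (measure_ne_top _ _)
    (ENNReal.prod_ne_top fun i _ => measure_ne_top _ _)).1 e4

namespace IsHeterogeneousNoiseProcess
variable {n T : ℕ} {q b : Fin n → (Fin n → ℝ) → ℝ} {z ε : ℕ → Ω → Fin n → ℝ}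

theorem map_noise (hz : IsHeterogeneousNoiseProcess μ T q b z ε) {t : ℕ} (ht : t < T) :
    μ.map (ε (t + 1)) = Measure.pi fun _ : Fin n => gaussianReal 0 1 := by
  have h := (iIndepFun_iff_map_fun_eq_pi_map fun k =>
    (hz.noise_law t ht k).aemeasurable).1 (hz.noise_indep t ht)
  simpa only [(hz.noise_law t ht _).map_eq] using h

/-- In the coordinates `φ`, the joint law of two consecutive states disintegrates along the
transition laws. -/
theorem exists_kernel (hz : IsHeterogeneousNoiseProcess μ T q b z ε) {t : ℕ} (ht : t < T)
    (hq : ∀ k, Continuous (q k)) (hb : ∀ k, Continuous (b k)) (hb_pos : ∀ k u, 0 < b k u)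
    (φ : (Fin n → ℝ) ≃ₜ (Fin n → ℝ)) :
    ∃ κ : Kernel (Fin n → ℝ) (Fin n → ℝ), IsFiniteKernel κ ∧
      (∀ u, κ (φ u) = (transitionLaw q b u).map φ) ∧
      μ.map (fun ω => (φ (z t ω), φ (z (t + 1) ω))) = μ.map (fun ω => φ (z t ω)) ⊗ₘ κ := by
  have hφ := φ.continuous.measurable
  have hS : Measurable fun w : (Fin n → ℝ) × (Fin n → ℝ) =>
      (fun k => q k (φ.symm w.1) + 1 / b k (φ.symm w.1) * w.2 k : Fin n → ℝ) := by
    have hs := φ.symm.continuous.measurable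
    refine measurable_pi_lambda _ fun k => ?_
    have h1 : Measurable fun w : (Fin n → ℝ) × (Fin n → ℝ) => φ.symm w.1 := hs.comp measurable_fst
    exact ((hq k).measurable.comp h1).add ((measurable_const.div ((hb k).measurable.comp h1)).mul
      ((measurable_pi_apply k).comp measurable_snd))
  have hF := hφ.comp hS
  refine ⟨randomMapKernel (Measure.pi fun _ : Fin n => gaussianReal 0 1) _, inferInstance,
    fun u => ?_, map_prodMk_eq_compProd_randomMapKernel (hφ.comp (hz.measurable_state t))
      (hz.measurable_noise (t + 1)) ((hz.noise_indep_state t ht).comp measurable_id hφ)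
      (hz.map_noise ht) hF ?_⟩
  · rw [randomMapKernel_apply _ hF, ← map_gaussian_noise hb_pos,
      Measure.map_map hφ (by fun_prop)]
    simp [Function.comp_def]
  · filter_upwards [hz.transition t ht] with ω hω
    simp only [Function.comp_apply, Homeomorph.symm_apply_apply]
    exact congrArg φ (funext hω)

/-- Every transition law charges all non-empty open sets, so their mixture does too, whatever the
law of `z t`. -/
theorem isOpenPosMeasure_map (hz : IsHeterogeneousNoiseProcess μ T q b z ε)
    (hq : ∀ k, Continuous (q k)) (hb : ∀ k, Continuous (b k)) (hb_pos : ∀ k u, 0 < b k u)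
    {t : ℕ} (ht : t < T) : (μ.map (z (t + 1))).IsOpenPosMeasure := by
  obtain ⟨κ, _, hκ, hjoint⟩ := hz.exists_kernel ht hq hb hb_pos (Homeomorph.refl _)
  simp only [Homeomorph.refl_apply, id_eq] at hκ hjoint
  have hzt := hz.measurable_state t
  have hzs := hz.measurable_state (t + 1)
  have : IsProbabilityMeasure (μ.map (z t)) := Measure.isProbabilityMeasure_map hzt.aemeasurable
  refine ⟨fun O hO hne h0 => ?_⟩
  have h1 : (μ.map fun ω => (z t ω, z (t + 1) ω)) (Prod.snd ⁻¹' O) = 0 := by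
    rw [Measure.map_apply (hzt.prodMk hzs) (measurable_snd hO.measurableSet)]
    rwa [Measure.map_apply hzs hO.measurableSet] at h0
  rw [hjoint, Measure.compProd_apply (measurable_snd hO.measurableSet),
    lintegral_eq_zero_iff (Kernel.measurable_kernel_prodMk_left (measurable_snd hO.measurableSet))]
    at h1
  obtain ⟨u, hu⟩ := h1.exists
  have := isOpenPosMeasure_transitionLaw (q := q) hb_pos u
  refine hO.measure_ne_zero (transitionLaw q b u) hne ?_
  have hu' : κ u O = 0 := hu
  rw [hκ u] at hu'
  simpa [Homeomorph.coe_refl] using hu'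

end IsHeterogeneousNoiseProcess

end

-- Identifiability of the latent state

theorem corollary1
    {Ω : Type*} [MeasurableSpace Ω] [StandardBorelSpace Ω]
    (μ : Measure Ω) [IsProbabilityMeasure μ]
    {X : Type*} [TopologicalSpace X]
    {n T : ℕ}
    (q b : Fin n → (Fin n → ℝ) → ℝ)
    (hq : ∀ k, Differentiable ℝ (q k))
    (hb : ∀ k, Differentiable ℝ (b k))
    (hb_pos : ∀ k u, 0 < b k u)
    (z ε : ℕ → Ω → Fin n → ℝ)
    (hz : IsHeterogeneousNoiseProcess μ T q b z ε)
    -- the observations `x_t = g(z_t)`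
    (g : (Fin n → ℝ) ≃ₜ X)
    (x : ℕ → Ω → X)
    (hx : ∀ t ω, x t ω = g (z t ω))
    -- the estimated latent variables `ẑ_t = f(x_t)`
    (f : X ≃ₜ (Fin n → ℝ))
    (zhat : ℕ → Ω → Fin n → ℝ)
    (hzhat : ∀ t ω, zhat t ω = f (x t ω))
    (hzhat_meas : ∀ t, Measurable (zhat t))
    -- one transition `t → t + 1`; for the first one, the initial law has full support
    (t : ℕ) (ht : t < T)
    (h_init : t = 0 → (μ.map (z 0)).IsOpenPosMeasure)
    -- the components of `ẑ_{t+1}` are mutually independent conditional on `ẑ_t`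
    (hindep : iCondIndepFun (MeasurableSpace.comap (zhat t) inferInstance)
      (hzhat_meas t).comap_le (fun i ω => zhat (t + 1) ω i) μ)
    -- linear independence, for each value of the current latent state
    (hlin : ∀ v : Fin n → ℝ, LinearIndependent ℝ (variabilityVectors q b v)) :
    ∃ (σ : Equiv.Perm (Fin n)) (τ : Fin n → (ℝ ≃ₜ ℝ)),
      (∀ y : X, ∀ k, g.symm y k = τ k (f y (σ k))) ∧
      (∀ s ω k, z s ω k = τ k (zhat s ω (σ k))) := by
  have hqc := fun k => (hq k).continuous
  have hbc := fun k => (hb k).continuous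
  have hfg : ∀ s, zhat s = fun ω => (g.trans f) (z s ω) := fun s =>
    funext fun ω => by rw [hzhat, hx]; rfl
  have hpos : (μ.map (z t)).IsOpenPosMeasure := by
    cases t with
    | zero => exact h_init rfl
    | succ s => exact hz.isOpenPosMeasure_map hqc hbc hb_pos (by omega)
  obtain ⟨κ, _, hκ, hjoint⟩ := hz.exists_kernel ht hqc hbc hb_pos (g.trans f)
  have hae : ∀ᵐ ω ∂μ, IsProductOnRationalBoxes ((transitionLaw q b (z t ω)).map (g.trans f)) := by
    have := ae_isProductOnRationalBoxes (hzhat_meas t) (hzhat_meas (t + 1)) hindep (κ := κ)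
      (by simpa only [hfg] using hjoint)
    filter_upwards [this] with ω hω
    rwa [hfg, hκ] at hω
  -- A non-empty open set has positive mass under the law of `z t`, so it meets the almost sure
  -- event.
  have hdense : Dense {u | IsProductOnRationalBoxes ((transitionLaw q b u).map (g.trans f))} := by
    refine dense_iff_inter_open.2 fun O hO hne => ?_
    have hO' : μ (z t ⁻¹' O) ≠ 0 := by
      rw [← Measure.map_apply (hz.measurable_state t) hO.measurableSet]
      exact hO.measure_ne_zero _ hne
    obtain ⟨ω, hωO, hω⟩ := ((frequently_ae_mem_iff.2 hO').and_eventually hae).exists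
    exact ⟨z t ω, hωO, hω⟩
  -- Changing `v` only adds multiples of the first family to the second, so the value `0` is as good
  -- as any.
  have hsep := additivelySeparable_of_dense hq hb hb_pos (hlin 0) (g.trans f).symm hdense
  obtain ⟨σ, τ, hστ⟩ := (g.trans f).symm.exists_perm_of_additivelySeparable
    (fun k => (hsep k).1) fun k => (hsep k).2
  refine ⟨σ, τ, fun y k => ?_, fun s ω k => ?_⟩
  · simpa using hστ (f y) k
  · rw [← hστ, hfg, Homeomorph.symm_apply_apply]
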